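/- Let $d$ be a natural number, let $F\subseteq\mathbb{Z}^d$ be a finite set of $k=|F|\ge 3$ points, let $r\ge 1$ be an integer (the number of colours), and let $\mu\in\left(0,\frac{k-1}{k}\right)$ be real. A homothetic copy of $F$ is a set of the form $v+\lambda F=\{v+\lambda f\colon f\in F\}$, where $v\in\mathbb{Z}^d$ and $\lambda$ is a positive integer. A set $Z\subseteq\mathbb{Z}^d$ is called $F$-free if there is no nonzero real number $\lambda$ such that $Z$ contains a congruent copy of $\lambda F$ (congruence being with respect to the Euclidean distance on $\mathbb{R}^d$). Write $\mathbb{N}=\{1,2,3,\dots\}$. Then there exists a finite set $X\subseteq\mathbb{N}^d$ such that (i) for every $r$-colouring of $X$ there is a monochromatic homothetic copy of $F$ contained in $X$, and (ii) every $Y\subseteq X$ has an $F$-free subset $Z\subseteq Y$ of size $|Z|\ge\mu|Y|$. -/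

import Mathlib

/-- The lattice point `x ∈ ℤ^d`, regarded as a point of Euclidean space `ℝ^d`. -/
noncomputable def latticePoint {d : ℕ} (x : Fin d → ℤ) : EuclideanSpace ℝ (Fin d) :=
  WithLp.toLp 2 (fun i => (x i : ℝ))

/-- `Z` contains a congruent copy of `t F`: there is a way of assigning to the points `f` of `F`
points `g f` of `Z` such that the configurations `(t f)` and `(g f)` are congruent in `ℝ^d`
(all distances agree, so reflections are allowed). -/
def ContainsCongruentCopy {d : ℕ} (F Z : Finset (Fin d → ℤ)) (t : ℝ) : Prop :=
  ∃ g : F → Fin d → ℤ, (∀ f, g f ∈ Z) ∧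
    Congruent (fun f : F => t • latticePoint (f : Fin d → ℤ)) (fun f : F => latticePoint (g f))

/-- `Z` is `F`-free: for no nonzero real `t` does `Z` contain a congruent copy of `t F`. -/
def IsFreeOf {d : ℕ} (F Z : Finset (Fin d → ℤ)) : Prop :=
  ¬ ∃ t : ℝ, t ≠ 0 ∧ ContainsCongruentCopy F Z t

/-- Under the colouring `c` of `X` by `r` colours, `X` contains a monochromatic homothetic copy
`v + m F` of `F`, where `v ∈ ℤ^d` and `m` is a positive integer. -/
def HasMonochromaticHomotheticCopy {d r : ℕ} (F X : Finset (Fin d → ℤ)) (c : X → Fin r) : Prop :=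
  ∃ (v : Fin d → ℤ) (m : ℤ), 0 < m ∧ ∃ j : Fin r,
    ∀ f ∈ F, ∃ h : v + m • f ∈ X, c ⟨v + m • f, h⟩ = j

/-!
The vertices of a hypergraph are the sets of `l * s` points, and each set of `l * s + 1` points
yields an edge, consisting of its `l + 1` subsets obtained by deleting one of `l + 1` evenly spaced
points. Any two edges share at most one vertex, and Ramsey's theorem gives monochromatic edges. Yet
there are independent sets of density close to `l / (l + 1)`: order the points at random, cut a
vertex into `l` windows of length `s`, and add up the positions of the minima of the windows. Along
an edge the minima are shared and the sums run over all residues modulo `l + 1`, so omitting one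
residue leaves no edge.

With `l + 1 = |F|`, partite amalgamation replaces the hypergraph by words over `F` labelled by its
vertices, such that every colouring of the words has a monochromatic combinatorial line, while `|F|`
words that are constant or pairwise distinct in every coordinate must have the vertices of an edge
as labels. The amalgamation rests on a Hales–Jewett theorem in which the wildcard set is taken from
a family containing no disjoint union of two of its members. Finally, a generic affine map to `ℤ^d`
sends lines to homothetic copies of `F` and creates no congruent copies of multiples of `F` other
than those coming from line-like families of words.
-/

open Combinatorics (Line)

/-- A family of nonempty sets no member of which is the union of two disjoint members. -/
def UnionFree {ι : Type*} (𝒲 : Set (Set ι)) : Prop :=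
  ∅ ∉ 𝒲 ∧ ∀ W₀ ∈ 𝒲, ∀ W₁ ∈ 𝒲, Disjoint W₀ W₁ → W₀ ∪ W₁ ∉ 𝒲

theorem UnionFree.image {ι ι' : Type*} {𝒲 : Set (Set ι)} (h𝒲 : UnionFree 𝒲) {g : ι → ι'}
    (hg : g.Injective) : UnionFree (Set.image g '' 𝒲) := by
  refine ⟨?_, ?_⟩
  · rintro ⟨W, hW, hempty⟩
    exact h𝒲.1 (Set.image_eq_empty.mp hempty ▸ hW)
  · rintro _ ⟨W₀, h₀, rfl⟩ _ ⟨W₁, h₁, rfl⟩ hdisj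
    rw [← Set.image_union, hg.image_injective.mem_set_image]
    exact h𝒲.2 W₀ h₀ W₁ h₁ ((Set.disjoint_image_iff hg).mp hdisj)

theorem unionFree_singleton_univ {ι : Type*} [Nonempty ι] : UnionFree {(Set.univ : Set ι)} := by
  refine ⟨fun h => Set.empty_ne_univ h, ?_⟩
  rintro _ rfl _ rfl hdisj
  exact absurd (disjoint_self.mp hdisj) Set.univ_nonempty.ne_empty

theorem UnionFree.blocks {ι T : Type*} {𝒟 : Set (Set T)} (h𝒟 : UnionFree 𝒟)
    {𝒲 : T → Set (Set ι)} (h𝒲 : ∀ t, UnionFree (𝒲 t)) (blk : ι → T) :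
    UnionFree {W | blk '' W ∈ 𝒟 ∧ ∀ t ∈ blk '' W, W ∩ blk ⁻¹' {t} ∈ 𝒲 t} := by
  refine ⟨fun h => h𝒟.1 (Set.image_empty blk ▸ h.1), ?_⟩
  rintro W₀ ⟨hD₀, h₀⟩ W₁ ⟨hD₁, h₁⟩ hdisj ⟨hD, h⟩
  rw [Set.image_union] at hD h
  by_cases hblk : Disjoint (blk '' W₀) (blk '' W₁)
  · exact h𝒟.2 _ hD₀ _ hD₁ hblk hD
  · obtain ⟨t, ht₀, ht₁⟩ := Set.not_disjoint_iff.mp hblk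
    refine (h𝒲 t).2 _ (h₀ t ht₀) _ (h₁ t ht₁)
      (hdisj.mono Set.inter_subset_left Set.inter_subset_left) ?_
    rw [← Set.union_inter_distrib_right]
    exact h t (Or.inl ht₀)

/-- The wildcard coordinates of a combinatorial line. -/
def wildcards {A ι : Type*} (L : Line A ι) : Set ι := {i | L.idxFun i = none}

/-- The Hales–Jewett property for lines whose wildcard set belongs to `𝒲`. The colour of the
line is not named, so that the property makes sense for the empty alphabet. -/
def IsHalesJewett {ι : Type*} (A κ : Type*) (𝒲 : Set (Set ι)) : Prop :=
  ∀ c : (ι → A) → κ, ∃ L : Line A ι, wildcards L ∈ 𝒲 ∧ ∀ a b, c (L a) = c (L b)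

theorem exists_shift_monochromatic {α κ : Type*} [LinearOrder α] [Fintype α] [Fintype κ]
    (hcard : Fintype.card (Set κ) < Fintype.card α) (c : α → α → κ) :
    ∃ i j l, i < j ∧ j < l ∧ c i j = c j l := by
  obtain ⟨i, j, hij, h⟩ := Fintype.exists_ne_map_eq_of_card_lt
    (fun j => {p | ∃ l, j < l ∧ c j l = p}) hcard
  wlog hlt : i < j generalizing i j
  · exact this j i hij.symm h.symm (hij.lt_or_gt.resolve_left hlt)
  have hmem : c i j ∈ {p | ∃ l, i < l ∧ c i l = p} := ⟨j, hlt, rfl⟩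
  obtain ⟨l, hjl, hcol⟩ := h ▸ hmem
  exact ⟨i, j, l, hlt, hjl, hcol.symm⟩

theorem adjacent_of_Ico_union_Ico_eq_Ico {α : Type*} [LinearOrder α] {a b a' b' a'' b'' : α}
    (h : a < b) (h' : a' < b') (h'' : a'' < b'')
    (hdisj : Disjoint (Set.Ico a b) (Set.Ico a' b'))
    (hunion : Set.Ico a b ∪ Set.Ico a' b' = Set.Ico a'' b'') :
    a = a'' ∧ b = a' ∧ b' = b'' ∨ a' = a'' ∧ b' = a ∧ b = b'' := by
  wlog hle : b ≤ a' generalizing a b a' b'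
  · have hle' : b' ≤ a := by
      have := Set.Ico_disjoint_Ico.mp hdisj
      grind
    exact (this h' h hdisj.symm (Set.union_comm _ _ ▸ hunion) hle').symm
  have hmem : ∀ x, (a ≤ x ∧ x < b ∨ a' ≤ x ∧ x < b') ↔ a'' ≤ x ∧ x < b'' := Set.ext_iff.mp hunion
  have ha : a = a'' := by grind [hmem a, hmem a'']
  have hb : b = a' := by grind [hmem a, hmem a', hmem b]
  have hsub := (Set.Ico_subset_Ico_iff h').mp (Set.subset_union_right.trans hunion.subset)
  have hb' : b' = b'' := by grind [hmem a', hmem b']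
  exact Or.inl ⟨ha, hb, hb'⟩

/-- The intervals `[(j, i), (l, j))` with `i < j < l` in the lexicographic order. -/
def shiftIntervals (α : Type*) [LinearOrder α] : Set (Set (α ×ₗ α)) :=
  {D | ∃ i j l, i < j ∧ j < l ∧ D = Set.Ico (toLex (j, i)) (toLex (l, j))}

theorem unionFree_shiftIntervals (α : Type*) [LinearOrder α] : UnionFree (shiftIntervals α) := by
  have hlt : ∀ {i j l : α}, j < l → toLex (j, i) < toLex (l, j) := fun h =>
    Prod.Lex.toLex_lt_toLex.mpr (Or.inl h)
  refine ⟨?_, ?_⟩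
  · rintro ⟨i, j, l, -, hjl, hempty⟩
    exact (Set.nonempty_Ico.mpr (hlt hjl)).ne_empty hempty.symm
  · rintro _ ⟨i, j, l, -, hjl, rfl⟩ _ ⟨i', j', l', -, hjl', rfl⟩ hdisj
      ⟨i'', j'', l'', -, hjl'', hunion⟩
    have hadj := adjacent_of_Ico_union_Ico_eq_Ico (hlt hjl) (hlt hjl') (hlt hjl'') hdisj hunion
    simp only [toLex_inj, Prod.mk.injEq] at hadj
    grind

theorem exists_unionFree_two_letters (κ : Type*) [Finite κ] :
    ∃ (T : Type) (_ : Finite T) (𝒟 : Set (Set T)), UnionFree 𝒟 ∧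
      ∀ c : Set T → κ, ∃ D ∈ 𝒟, ∃ S, Disjoint S D ∧ c S = c (S ∪ D) := by
  classical
  have := Fintype.ofFinite κ
  let α := Fin (Fintype.card (Set κ) + 1)
  refine ⟨α ×ₗ α, inferInstanceAs (Finite (α × α)), shiftIntervals α, unionFree_shiftIntervals α,
    fun c => ?_⟩
  obtain ⟨i, j, l, hij, hjl, hcol⟩ := exists_shift_monochromatic (by simp [α])
    fun i j : α => c (Set.Iio (toLex (j, i)))
  have hlt : toLex (j, i) < toLex (l, j) := Prod.Lex.toLex_lt_toLex.mpr (Or.inl hjl)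
  refine ⟨_, ⟨i, j, l, hij, hjl, rfl⟩, Set.Iio (toLex (j, i)), ?_, ?_⟩
  · exact Set.disjoint_left.mpr fun x hx hx' => hx.not_ge hx'.1
  · rw [Set.Iio_union_Ico_eq_Iio hlt.le, hcol]

/-- The colour of a word obtained by filling the wildcards of the partial word `L`, all those in
one block with the same letter or with `none`, depends only on the blocks that are filled with
`none`. -/
def IsInsensitive {A ι T κ : Type*} (blk : ι → T) (L : ι → Option A) (c : (ι → Option A) → κ) :
    Prop :=
  ∀ x y : T → Option A, (∀ t, x t = none ↔ y t = none) →
    c (fun i => (L i).or (x (blk i))) = c (fun i => (L i).or (y (blk i)))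

theorem IsInsensitive.sumElim {A ι ι₀ T κ : Type*} {blk : ι → T} {L : ι → Option A}
    {L₀ : Line A ι₀} {c : (ι ⊕ ι₀ → Option A) → κ}
    (hL : IsInsensitive blk L fun v a => c (Sum.elim v fun i => (L₀.idxFun i).or a))
    (hL₀ : ∀ a b, (fun v => c (Sum.elim v (some ∘ L₀ a))) = fun v => c (Sum.elim v (some ∘ L₀ b))) :
    IsInsensitive (Sum.elim (some ∘ blk) fun _ => none) (Sum.elim L L₀.idxFun) c := by
  intro x y hxy
  let word (v : T → Option A) (a : Option A) : ι ⊕ ι₀ → Option A :=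
    Sum.elim (fun i => (L i).or (v (blk i))) fun i => (L₀.idxFun i).or a
  have word_eq (z : Option T → Option A) :
      (fun i => (Sum.elim L L₀.idxFun i).or (z ((Sum.elim (some ∘ blk) fun _ => none) i))) =
        word (z ∘ some) (z none) := by
    ext1 (i | i) <;> rfl
  have change_old : c (word (x ∘ some) (x none)) = c (word (y ∘ some) (x none)) :=
    congrFun (hL (x ∘ some) (y ∘ some) fun t => hxy _) (x none)
  have change_new (a b : A) : c (word (y ∘ some) (some a)) = c (word (y ∘ some) (some b)) := by
    have line_eq (a : A) : some ∘ L₀ a = fun i => (L₀.idxFun i).or (some a) := by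
      ext1 i
      cases h : L₀.idxFun i <;> simp [h, Line.coe_apply]
    have hcol := congrFun (hL₀ a b) fun i => (L i).or (y (some (blk i)))
    simp only [line_eq] at hcol
    exact hcol
  rw [word_eq, word_eq, change_old]
  have hnone := hxy none
  rcases hx : x none with _ | a <;> rcases hy : y none with _ | b
  · rfl
  · simp [hx, hy] at hnone
  · simp [hx, hy] at hnone
  · exact change_new a b

theorem exists_insensitive_blocks {A : Type} [Finite A]
    (hA : ∀ (κ : Type) [Finite κ], ∃ (ι : Type) (_ : Finite ι) (𝒲 : Set (Set ι)),
      UnionFree 𝒲 ∧ IsHalesJewett A κ 𝒲) (T : Type) [Finite T] :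
    ∀ (κ : Type) [Finite κ], ∃ (ι : Type) (_ : Finite ι) (blk : ι → T) (𝒲 : T → Set (Set ι)),
      (∀ t, UnionFree (𝒲 t)) ∧ ∀ c : (ι → Option A) → κ, ∃ L : ι → Option A,
        (∀ t, {i | L i = none ∧ blk i = t} ∈ 𝒲 t) ∧ IsInsensitive blk L c := by
  induction T using Finite.induction_empty_option with
  | of_equiv e ih =>
    intro κ _
    obtain ⟨ι, hι, blk, 𝒲, h𝒲, hins⟩ := ih κ
    refine ⟨ι, hι, e ∘ blk, 𝒲 ∘ e.symm, fun t => h𝒲 _, fun c => ?_⟩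
    obtain ⟨L, hL, hc⟩ := hins c
    refine ⟨L, fun t => ?_, fun x y hxy => hc (x ∘ e) (y ∘ e) fun t => hxy _⟩
    simpa only [Function.comp_apply, Equiv.eq_symm_apply] using hL (e.symm t)
  | h_empty =>
    intro κ _
    exact ⟨Empty, inferInstance, Empty.elim, fun t => t.elim, fun t => t.elim, fun c =>
      ⟨Empty.elim, fun t => t.elim, fun x y _ => congrArg c (funext fun i => i.elim)⟩⟩
  | @h_option T _ ih =>
    intro κ _
    obtain ⟨ι', _, blk', 𝒲', h𝒲', hins⟩ := ih (Option A → κ)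
    obtain ⟨ι₀, _, 𝒲₀, h𝒲₀, hHJ⟩ := hA ((ι' → Option A) → κ)
    refine ⟨ι' ⊕ ι₀, inferInstance, Sum.elim (some ∘ blk') fun _ => none,
      fun t => t.elim (Set.image Sum.inr '' 𝒲₀) fun t => Set.image Sum.inl '' 𝒲' t,
      ?_, fun c => ?_⟩
    · rintro (_ | t)
      · exact h𝒲₀.image Sum.inr_injective
      · exact (h𝒲' t).image Sum.inl_injective
    obtain ⟨L₀, hL₀, hc₀⟩ := hHJ fun w v => c (Sum.elim v (some ∘ w))
    obtain ⟨L', hL', hc'⟩ := hins fun v a => c (Sum.elim v fun i => (L₀.idxFun i).or a)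
    refine ⟨Sum.elim L' L₀.idxFun, ?_, hc'.sumElim hc₀⟩
    rintro (_ | t)
    · exact ⟨_, hL₀, by ext (i | i) <;> simp [wildcards]⟩
    · exact ⟨_, hL' t, by ext (i | i) <;> simp⟩

theorem exists_line_of_insensitive {A ι T κ : Type*} [Nonempty A] {𝒟 : Set (Set T)}
    (hempty : ∅ ∉ 𝒟) (h𝒟 : ∀ c : Set T → κ, ∃ D ∈ 𝒟, ∃ S, Disjoint S D ∧ c S = c (S ∪ D))
    {blk : ι → T} {L : ι → Option A} (hL : ∀ t, ∃ i, L i = none ∧ blk i = t)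
    {c : (ι → Option A) → κ} (hins : IsInsensitive blk L c) :
    ∃ D ∈ 𝒟, ∃ L' : Line (Option A) ι, wildcards L' = {i | L i = none ∧ blk i ∈ D} ∧
      ∀ a b, c (L' a) = c (L' b) := by
  classical
  obtain ⟨a₀⟩ := ‹Nonempty A›
  let newOn (S : Set T) (t : T) : Option A := if t ∈ S then none else some a₀
  obtain ⟨D, hD, S, hSD, hcol⟩ := h𝒟 fun S => c fun i => (L i).or (newOn S (blk i))
  obtain ⟨t, ht⟩ := Set.nonempty_iff_ne_empty.mpr (ne_of_mem_of_not_mem hD hempty)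
  obtain ⟨i₀, hi₀, hblk⟩ := hL t
  let L' : Line (Option A) ι :=
    { idxFun i := (L i).elim (if blk i ∈ D then none else some (newOn S (blk i))) (some ∘ some)
      proper := ⟨i₀, by simp [hi₀, hblk, ht]⟩ }
  let fillOn (a : Option A) (t : T) : Option A := if t ∈ D then a else newOn S t
  have apply_eq (a : Option A) : L' a = fun i => (L i).or (fillOn a (blk i)) := by
    ext1 i
    rcases hi : L i with _ | b
    · by_cases hiD : blk i ∈ D <;> simp [L', fillOn, Line.coe_apply, hi, hiD]
    · simp [L', Line.coe_apply, hi]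
  have colour_eq (a : Option A) : c (L' a) = c fun i => (L i).or (newOn S (blk i)) := by
    rw [apply_eq]
    rcases a with _ | a
    · rw [hcol]
      refine hins (fillOn none) (newOn (S ∪ D)) fun t => ?_
      by_cases htD : t ∈ D <;> simp [fillOn, newOn, htD]
    · refine hins (fillOn (some a)) (newOn S) fun t => ?_
      by_cases htD : t ∈ D
      · simp [fillOn, newOn, htD, hSD.notMem_of_mem_right htD]
      · simp [fillOn, htD]
  refine ⟨D, hD, L', ?_, fun a b => (colour_eq a).trans (colour_eq b).symm⟩
  ext i
  rcases hi : L i with _ | b <;> simp [wildcards, L', hi]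

theorem isHalesJewett_of_subsingleton (A κ : Type*) [Subsingleton A] :
    IsHalesJewett A κ {(Set.univ : Set Unit)} := fun _ =>
  ⟨⟨fun _ => none, ⟨(), rfl⟩⟩, by simp [wildcards], fun a b => by rw [Subsingleton.elim a b]⟩

theorem exists_unionFree_halesJewett_option {A κ : Type} [Finite A] [Nonempty A] [Finite κ]
    (hA : ∀ (κ : Type) [Finite κ], ∃ (ι : Type) (_ : Finite ι) (𝒲 : Set (Set ι)),
      UnionFree 𝒲 ∧ IsHalesJewett A κ 𝒲) :
    ∃ (ι : Type) (_ : Finite ι) (𝒲 : Set (Set ι)),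
      UnionFree 𝒲 ∧ IsHalesJewett (Option A) κ 𝒲 := by
  obtain ⟨T, _, 𝒟, hD, hT⟩ := exists_unionFree_two_letters κ
  obtain ⟨ι, hι, blk, 𝒲, hW, hblocks⟩ := exists_insensitive_blocks hA T κ
  refine ⟨ι, hι, _, hD.blocks hW blk, fun c => ?_⟩
  obtain ⟨L, hL, hins⟩ := hblocks c
  have hne (t : T) : {i | L i = none ∧ blk i = t}.Nonempty :=
    Set.nonempty_iff_ne_empty.mpr (ne_of_mem_of_not_mem (hL t) (hW t).1)
  obtain ⟨D, hDmem, L', hL', hcol⟩ := exists_line_of_insensitive hD.1 hT hne hins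
  refine ⟨L', ?_, hcol⟩
  have himage : blk '' wildcards L' = D := by
    rw [hL']
    ext t
    constructor
    · rintro ⟨i, hi, rfl⟩
      exact hi.2
    · intro ht
      obtain ⟨i, hi, rfl⟩ := hne t
      exact ⟨i, ⟨hi, ht⟩, rfl⟩
  refine ⟨himage.symm ▸ hDmem, fun t ht => ?_⟩
  rw [himage] at ht
  convert hL t using 1
  ext i
  simp only [hL', Set.mem_inter_iff, Set.mem_ofPred_eq, Set.mem_preimage, Set.mem_singleton_iff]
  grind

theorem exists_unionFree_halesJewett (A : Type) [Finite A] :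
    ∀ (κ : Type) [Finite κ], ∃ (ι : Type) (_ : Finite ι) (𝒲 : Set (Set ι)),
      UnionFree 𝒲 ∧ IsHalesJewett A κ 𝒲 := by
  induction A using Finite.induction_empty_option with
  | of_equiv e ih =>
    intro κ _
    obtain ⟨ι, hι, 𝒲, h𝒲, hHJ⟩ := ih κ
    refine ⟨ι, hι, 𝒲, h𝒲, fun c => ?_⟩
    obtain ⟨L, hL, hcol⟩ := hHJ fun w => c (e ∘ w)
    refine ⟨L.map e, by simpa [wildcards, Line.map] using hL, fun a b => ?_⟩
    simpa only [← Line.map_apply, e.apply_symm_apply] using hcol (e.symm a) (e.symm b)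
  | h_empty =>
    intro κ _
    exact ⟨Unit, inferInstance, _, unionFree_singleton_univ, isHalesJewett_of_subsingleton _ _⟩
  | @h_option A _ ih =>
    intro κ _
    rcases isEmpty_or_nonempty A with hA | hA
    · exact ⟨Unit, inferInstance, _, unionFree_singleton_univ, isHalesJewett_of_subsingleton _ _⟩
    · exact exists_unionFree_halesJewett_option ih

/-- The tuple `u` lists the vertices of an edge of the hypergraph `ℰ` without repetition. -/
def IsEdgeTuple {K V : Type*} (ℰ : Set (Set V)) (u : K → V) : Prop :=
  Function.Injective u ∧ Set.range u ∈ ℰ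

/-- A hypergraph any two distinct edges of which share at most one vertex. -/
def IsLinearHypergraph {V : Type*} (ℰ : Set (Set V)) : Prop :=
  ℰ.Pairwise fun e e' => (e ∩ e').Subsingleton

/-- A family of words in which every coordinate is constant or injective, and some coordinate is
injective. It is a combinatorial line up to permutations of the letters in the coordinates. -/
def IsQuasiLine {K κ : Type*} (g : K → κ → K) : Prop :=
  (∃ x, Function.Injective fun f => g f x) ∧
    ∀ x, (Function.Injective fun f => g f x) ∨ ∀ f f', g f x = g f' x

/-- A picture over the hypergraph `ℰ` in the sense of partite amalgamation: some words over `K`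
are labelled by vertices of `ℰ` so that every labelled quasi-line lies over an edge, and for every
`C`-colouring of the words there is a choice of one line over each edge on which the colour of a
word with label in `S` depends only on the label. -/
structure IsPicture {K V κ : Type*} (ℰ : Set (Set V)) (C : Type*) (S : Set V)
    (Lab : (κ → K) → V → Prop) : Prop where
  functional : Relator.RightUnique Lab
  faithful : ∀ g : K → κ → K, IsQuasiLine g → ∀ u : K → V, (∀ f, Lab (g f) (u f)) →
    IsEdgeTuple ℰ u
  ramsey : ∀ c : (κ → K) → C, ∃ χ : V → C, ∀ u : K → V, IsEdgeTuple ℰ u → ∃ L : Line K κ,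
    (∀ f, Lab (L f) (u f)) ∧ ∀ f, u f ∈ S → c (L f) = χ (u f)

section BasePicture

variable {K E : Type*}

open Classical in
/-- Pairwise disjoint combinatorial lines: the coordinate `none` is the only wildcard, and the
coordinates `some b` spell out which line it is. -/
noncomputable def disjointLine (k₀ k₁ : K) (a : E) : Line K (Option E) where
  idxFun x := x.elim none fun b => some (if b = a then k₁ else k₀)
  proper := ⟨none, rfl⟩

open Classical in
theorem disjointLine_apply_some (k₀ k₁ : K) (a : E) (f : K) (b : E) :
    disjointLine k₀ k₁ a f (some b) = if b = a then k₁ else k₀ := rfl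

theorem disjointLine_apply_some_eq_iff {k₀ k₁ : K} (hk : k₀ ≠ k₁) {a a' : E} {f f' : K} :
    disjointLine k₀ k₁ a f (some a) = disjointLine k₀ k₁ a' f' (some a) ↔ a = a' := by
  simp only [disjointLine_apply_some]
  grind

theorem not_injective_disjointLine_apply_some (hK : 3 ≤ ENat.card K) {k₀ k₁ : K} (hk : k₀ ≠ k₁)
    (a : K → E) (σ : K → K) (b : E) :
    ¬ Function.Injective fun f => disjointLine k₀ k₁ (a f) (σ f) (some b) := by
  intro hinj
  obtain ⟨k, h₀, h₁⟩ := ENat.exists_ne_ne_of_three_le hK k₀ k₁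
  have h₀₁ := hinj.ne hk
  have h₀₂ := hinj.ne h₀
  have h₁₂ := hinj.ne h₁
  simp only [disjointLine_apply_some] at h₀₁ h₀₂ h₁₂
  grind

theorem exists_base_picture {K V : Type} [Finite K] [Finite V] (hK : 3 ≤ ENat.card K)
    (ℰ : Set (Set V)) (C : Type*) [Nonempty C] :
    ∃ (κ : Type) (_ : Finite κ) (Lab : (κ → K) → V → Prop), IsPicture ℰ C ∅ Lab := by
  have : Nontrivial K := (ENat.one_lt_card_iff_nontrivial K).mp (lt_of_lt_of_le (by norm_num) hK)
  obtain ⟨k₀, k₁, hk⟩ := exists_pair_ne K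
  let E := {u : K → V // IsEdgeTuple ℰ u}
  refine ⟨Option E, inferInstance,
    fun w v => ∃ (a : E) (f : K), w = disjointLine k₀ k₁ a f ∧ v = a.1 f, ?_, ?_, ?_⟩
  · rintro w v v' ⟨a, f, rfl, rfl⟩ ⟨a', f', h, rfl⟩
    obtain rfl := (disjointLine_apply_some_eq_iff hk).mp (congrFun h (some a))
    exact congrArg a.1 (congrFun h none)
  · rintro g ⟨⟨x, hx⟩, hcoord⟩ u hu
    choose a σ hg hu using hu
    obtain rfl : g = fun f => disjointLine k₀ k₁ (a f) (σ f) := funext hg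
    have ha : ∀ f, a f = a k₀ := fun f => (disjointLine_apply_some_eq_iff hk).mp
      ((hcoord _).resolve_left (not_injective_disjointLine_apply_some hK hk a σ _) f k₀)
    obtain rfl : u = (a k₀).1 ∘ σ := funext fun f => by rw [hu f, ha f, Function.comp_apply]
    have hσ : Function.Injective σ := fun f f' hff => hx (by simp only [ha f, ha f', hff])
    refine ⟨(a k₀).2.1.comp hσ, ?_⟩
    rw [Set.range_comp, (Finite.surjective_of_injective hσ).range_eq, Set.image_univ]
    exact (a k₀).2.2
  · exact fun c => ⟨fun _ => Classical.arbitrary C, fun u hu =>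
      ⟨disjointLine k₀ k₁ ⟨u, hu⟩, fun f => ⟨⟨u, hu⟩, f, rfl, rfl⟩, fun f hf => hf.elim⟩⟩

end BasePicture

section UnionFreeEdges

-- Below, `y i f` is the label of the letter in position `i` of the `f`-th word of a quasi-line in
-- the amalgam, and `u f` is the label of that word.

variable {ι K V : Type*} {y : ι → K → V} {u : K → V} {v : V}

theorem disjoint_and_union_eq_of_apply_eq (hu : ∀ i f, y i f ≠ v → y i f = u f)
    (hy : ∀ i, (∀ f f', y i f = y i f') ∨ Function.Injective (y i)) {f₀ f₁ f₂ : K}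
    (h₀₁ : f₀ ≠ f₁) (h₀₂ : f₂ ≠ f₀) (h₁₂ : f₂ ≠ f₁) (hrep : u f₀ = u f₁) (hne : u f₀ ≠ u f₂) :
    Disjoint {i | y i f₀ ≠ v} {i | y i f₁ ≠ v} ∧
      {i | y i f₀ ≠ v} ∪ {i | y i f₁ ≠ v} = {i | y i f₂ ≠ v} := by
  have hdisj (i : ι) (h₀ : y i f₀ ≠ v) : y i f₁ = v := by
    by_contra h₁
    have hconst := (hy i).resolve_right fun hinj =>
      h₀₁ (hinj (by rw [hu i f₀ h₀, hu i f₁ h₁, hrep]))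
    have h₂ : y i f₂ ≠ v := hconst f₀ f₂ ▸ h₀
    exact hne (by rw [← hu i f₀ h₀, ← hu i f₂ h₂, hconst f₀ f₂])
  refine ⟨Set.disjoint_left.mpr fun i h₀ h₁ => h₁ (hdisj i h₀), ?_⟩
  ext i
  simp only [Set.mem_union, Set.mem_ofPred_eq]
  rcases hy i with hconst | hinj
  · have := hconst f₀ f₂
    have := hconst f₁ f₂
    grind
  · have := hinj.ne h₀₁
    have := hinj.ne h₀₂
    have := hinj.ne h₁₂
    grind

variable {ℰ : Set (Set V)}

theorem exists_ne_apply_eq_of_apply_eq (hK : 3 ≤ ENat.card K) (hℰ : IsLinearHypergraph ℰ)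
    (hu : ∀ i f, y i f ≠ v → y i f = u f)
    (hy : ∀ i, (∀ f f', y i f = y i f') ∨ IsEdgeTuple ℰ (y i)) {i₀ j : ι} {f₀ : K}
    (hi₀ : IsEdgeTuple ℰ (y i₀)) (hf₀ : y i₀ f₀ = v) (hj : y j f₀ ≠ v) :
    ∃ f₁ ≠ f₀, u f₁ = u f₀ := by
  have hne {f : K} (hf : f ≠ f₀) : y i₀ f ≠ v := hf₀ ▸ hi₀.1.ne hf
  have hu_eq {f : K} (hf : f ≠ f₀) : u f = y i₀ f := (hu i₀ f (hne hf)).symm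
  suffices hmem : y j f₀ ∈ Set.range (y i₀) by
    obtain ⟨f₁, hf₁⟩ := hmem
    have h₁ : f₁ ≠ f₀ := by
      rintro rfl
      exact hj (hf₁ ▸ hf₀)
    exact ⟨f₁, h₁, by rw [hu_eq h₁, hf₁, hu j f₀ hj]⟩
  obtain ⟨f, hf, -⟩ := ENat.exists_ne_ne_of_three_le hK f₀ f₀
  obtain ⟨f', hf', hff'⟩ := ENat.exists_ne_ne_of_three_le hK f₀ f
  rcases hy j with hconst | hedge
  · have hcol (f : K) : y j f₀ = u f := hconst f f₀ ▸ hu j f (hconst f f₀ ▸ hj)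
    exact absurd (hi₀.1 (by rw [← hu_eq hf', ← hu_eq hf, ← hcol, ← hcol])) hff'
  · have hshared {f : K} (hf : f ≠ f₀) : y j f ∈ Set.range (y i₀) := by
      by_cases hv : y j f = v
      · exact ⟨f₀, hf₀.trans hv.symm⟩
      · exact ⟨f, by rw [hu j f hv, hu_eq hf]⟩
    have hrange : Set.range (y j) = Set.range (y i₀) := hℰ.eq hedge.2 hi₀.2 fun hsub =>
      hff' (hedge.1 (hsub ⟨⟨f', rfl⟩, hshared hf'⟩ ⟨⟨f, rfl⟩, hshared hf⟩))
    exact hrange ▸ Set.mem_range_self f₀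

theorem isEdgeTuple_of_unionFree (hK : 3 ≤ ENat.card K) (hℰ : IsLinearHypergraph ℰ)
    {𝒲 : Set (Set ι)} (h𝒲 : UnionFree 𝒲) (hu : ∀ i f, y i f ≠ v → y i f = u f)
    (hW : ∀ f, u f ≠ v → {i | y i f ≠ v} ∈ 𝒲)
    (hy : ∀ i, (∀ f f', y i f = y i f') ∨ IsEdgeTuple ℰ (y i)) {i₀ : ι}
    (hi₀ : IsEdgeTuple ℰ (y i₀)) : IsEdgeTuple ℰ u := by
  suffices hu_eq : u = y i₀ from hu_eq ▸ hi₀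
  funext f₀
  by_cases hf₀ : y i₀ f₀ = v
  swap
  · exact (hu i₀ f₀ hf₀).symm
  rw [hf₀]
  by_contra huv
  obtain ⟨j, hj⟩ := Set.nonempty_iff_ne_empty.mpr (ne_of_mem_of_not_mem (hW f₀ huv) h𝒲.1)
  obtain ⟨f₁, h₁₀, hrep⟩ := exists_ne_apply_eq_of_apply_eq hK hℰ hu hy hi₀ hf₀ hj
  obtain ⟨f₂, h₂₀, h₂₁⟩ := ENat.exists_ne_ne_of_three_le hK f₀ f₁
  have hne {f : K} (hf : f ≠ f₀) : y i₀ f ≠ v := hf₀ ▸ hi₀.1.ne hf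
  have hu₁₂ : u f₁ ≠ u f₂ := by
    rw [← hu i₀ f₁ (hne h₁₀), ← hu i₀ f₂ (hne h₂₀)]
    exact hi₀.1.ne h₂₁.symm
  obtain ⟨hdisj, hunion⟩ := disjoint_and_union_eq_of_apply_eq hu
    (fun i => (hy i).imp_right And.left) h₁₀.symm h₂₀ h₂₁ hrep.symm (hrep ▸ hu₁₂)
  have hu₂ : u f₂ ≠ v := hu i₀ f₂ (hne h₂₀) ▸ hne h₂₀
  exact h𝒲.2 _ (hW f₀ huv) _ (hW f₁ (hrep ▸ huv)) hdisj (hunion ▸ hW f₂ hu₂)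

end UnionFreeEdges

section Amalgamation

variable {K V κ ι : Type*}

/-- The labelling of words of words used in partite amalgamation: either all letters have the
label `v`, or the letters without the label `v` are all equal and occupy a set of positions in
`𝒲`. -/
def amalgam (Lab : (κ → K) → V → Prop) (v : V) (𝒲 : Set (Set ι)) (w : ι × κ → K) (u : V) : Prop :=
  (u = v ∧ ∀ i, Lab (w.curry i) v) ∨
    (u ≠ v ∧ ∃ p, Lab p u ∧ ∃ W ∈ 𝒲, (∀ i ∈ W, w.curry i = p) ∧ ∀ i ∉ W, Lab (w.curry i) v)

variable {Lab : (κ → K) → V → Prop} {v : V} {𝒲 : Set (Set ι)}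

theorem exists_letter_labels {w : ι × κ → K} {u : V}
    (hw : amalgam Lab v 𝒲 w u) :
    ∃ y : ι → V, (∀ i, Lab (w.curry i) (y i)) ∧ (∀ i, y i ≠ v → y i = u) ∧
      (u ≠ v → {i | y i ≠ v} ∈ 𝒲) := by
  classical
  rcases hw with ⟨rfl, hv⟩ | ⟨huv, p, hp, W, hW, hin, hout⟩
  · exact ⟨fun _ => u, hv, fun _ _ => rfl, fun h => absurd rfl h⟩
  · refine ⟨fun i => if i ∈ W then u else v, fun i => ?_, fun i hi => ?_, fun _ => ?_⟩
    · dsimp only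
      split_ifs with hi
      · exact hin i hi ▸ hp
      · exact hout i hi
    · grind
    · simpa [huv] using hW

theorem rightUnique_amalgam (hLab : Relator.RightUnique Lab) (hempty : ∅ ∉ 𝒲) :
    Relator.RightUnique (amalgam Lab v 𝒲) := by
  intro w u u' hu hu'
  wlog huv : u ≠ v generalizing u u'
  · by_cases huv' : u' = v
    · rw [not_not.mp huv, huv']
    · exact (this hu' hu huv').symm
  obtain ⟨y, hy, hyu, hW⟩ := exists_letter_labels hu
  obtain ⟨y', hy', hyu', -⟩ := exists_letter_labels hu'
  obtain ⟨i, hi⟩ := Set.nonempty_iff_ne_empty.mpr (ne_of_mem_of_not_mem (hW huv) hempty)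
  have hyy' : y i = y' i := hLab (hy i) (hy' i)
  rw [← hyu i hi, hyy', hyu' i (hyy' ▸ hi)]

theorem IsPicture.faithful_amalgam {ℰ : Set (Set V)} {C : Type*} {S : Set V}
    (hP : IsPicture ℰ C S Lab) (hK : 3 ≤ ENat.card K) (hℰ : IsLinearHypergraph ℰ)
    (h𝒲 : UnionFree 𝒲) {g : K → ι × κ → K} (hg : IsQuasiLine g) {u : K → V}
    (hu : ∀ f, amalgam Lab v 𝒲 (g f) (u f)) : IsEdgeTuple ℰ u := by
  choose y hy hyu hW using fun f => exists_letter_labels (hu f)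
  have hedge {i : ι} {x : κ} (hx : Function.Injective fun f => g f (i, x)) :
      IsEdgeTuple ℰ fun f => y f i :=
    hP.faithful (fun f => (g f).curry i) ⟨⟨x, hx⟩, fun x => hg.2 (i, x)⟩ _ fun f => hy f i
  obtain ⟨⟨⟨i₀, x₀⟩, hx₀⟩, hcoord⟩ := hg
  refine isEdgeTuple_of_unionFree (y := fun i f => y f i) hK hℰ h𝒲 (fun i f => hyu f i) hW
    (fun i => ?_) (hedge hx₀)
  by_cases hinj : ∃ x, Function.Injective fun f => g f (i, x)
  · exact Or.inr (hedge hinj.choose_spec)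
  · push Not at hinj
    refine Or.inl fun f f' => hP.functional (hy f i) ?_
    have hcurry : (g f).curry i = (g f').curry i :=
      funext fun x => (hcoord (i, x)).resolve_left (hinj x) f f'
    exact hcurry ▸ hy f' i

/-- The word of words obtained from a line of words by substituting `p` for the wildcards. -/
def substWord {P : (κ → K) → Prop} (Λ : Line {w // P w} ι) (p : κ → K) : ι × κ → K :=
  Function.uncurry fun i => (Λ.idxFun i).elim p Subtype.val

/-- The line of words of words obtained by substituting a line for the wildcards of a line of
words. -/
def substLine {P : (κ → K) → Prop} (Λ : Line {w // P w} ι) (L : Line K κ) : Line K (ι × κ) where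
  idxFun z := (Λ.idxFun z.1).elim (L.idxFun z.2) fun p => some (p.1 z.2)
  proper := by
    obtain ⟨i, hi⟩ := Λ.proper
    obtain ⟨x, hx⟩ := L.proper
    exact ⟨(i, x), by simp [hi, hx]⟩

theorem substLine_apply {P : (κ → K) → Prop} (Λ : Line {w // P w} ι) (L : Line K κ) (f : K) :
    substLine Λ L f = substWord Λ (L f) := by
  ext1 ⟨i, x⟩
  rcases h : Λ.idxFun i with _ | p <;> simp [substLine, substWord, Line.coe_apply, h]

theorem substWord_val {P : (κ → K) → Prop} (Λ : Line {w // P w} ι) (p : {w // P w}) :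
    substWord Λ p.1 = Function.uncurry fun i => (Λ p i).1 := by
  ext1 ⟨i, x⟩
  rcases h : Λ.idxFun i with _ | q <;> simp [substWord, Line.coe_apply, h]

theorem amalgam_substWord {Λ : Line {w // Lab w v} ι} (hΛ : wildcards Λ ∈ 𝒲) {p : κ → K} {u : V}
    (hp : Lab p u) : amalgam Lab v 𝒲 (substWord Λ p) u := by
  have hwild {i : ι} (hi : Λ.idxFun i = none) : (substWord Λ p).curry i = p := by
    simp [substWord, hi]
  have hfixed {i : ι} (hi : Λ.idxFun i ≠ none) : Lab ((substWord Λ p).curry i) v := by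
    obtain ⟨q, hq⟩ := Option.ne_none_iff_exists'.mp hi
    simpa [substWord, hq] using q.2
  by_cases huv : u = v
  · subst huv
    refine Or.inl ⟨rfl, fun i => ?_⟩
    by_cases hi : Λ.idxFun i = none
    · exact (hwild hi).symm ▸ hp
    · exact hfixed hi
  · exact Or.inr ⟨huv, p, hp, _, hΛ, fun i => hwild, fun i => hfixed⟩

theorem IsPicture.ramsey_amalgam {ℰ : Set (Set V)} {C : Type*} {S : Set V}
    (hP : IsPicture ℰ C S Lab) (hHJ : IsHalesJewett {w // Lab w v} C 𝒲) (c : (ι × κ → K) → C) :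
    ∃ χ : V → C, ∀ u : K → V, IsEdgeTuple ℰ u → ∃ L : Line K (ι × κ),
      (∀ f, amalgam Lab v 𝒲 (L f) (u f)) ∧ ∀ f, u f ∈ insert v S → c (L f) = χ (u f) := by
  classical
  obtain ⟨Λ, hΛ, hcol⟩ := hHJ fun w => c (Function.uncurry fun i => (w i).1)
  obtain ⟨χ, hχ⟩ := hP.ramsey fun p => c (substWord Λ p)
  obtain ⟨j, hj⟩ : ∃ j, ∀ p, Lab p v → c (substWord Λ p) = j := by
    rcases isEmpty_or_nonempty {w // Lab w v} with hnone | ⟨⟨q⟩⟩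
    · exact ⟨χ v, fun p hp => isEmptyElim (⟨p, hp⟩ : {w // Lab w v})⟩
    · refine ⟨c (substWord Λ q.1), fun p hp => ?_⟩
      rw [substWord_val, substWord_val Λ ⟨p, hp⟩, hcol]
  refine ⟨Function.update χ v j, fun u hu => ?_⟩
  obtain ⟨L, hlab, hL⟩ := hχ u hu
  refine ⟨substLine Λ L, fun f => substLine_apply Λ L f ▸ amalgam_substWord hΛ (hlab f),
    fun f hf => ?_⟩
  rw [substLine_apply]
  by_cases hv : u f = v
  · rw [hv, Function.update_self, hj _ (hv ▸ hlab f)]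
  · rw [Function.update_of_ne hv, hL f (hf.resolve_left hv)]

theorem IsPicture.amalgam {ℰ : Set (Set V)} {C : Type*} {S : Set V}
    (hP : IsPicture ℰ C S Lab) (hK : 3 ≤ ENat.card K) (hℰ : IsLinearHypergraph ℰ)
    (h𝒲 : UnionFree 𝒲) (hHJ : IsHalesJewett {w // Lab w v} C 𝒲) :
    IsPicture ℰ C (insert v S) (amalgam Lab v 𝒲) where
  functional := rightUnique_amalgam hP.functional h𝒲.1
  faithful _ hg _ := hP.faithful_amalgam hK hℰ h𝒲 hg
  ramsey := hP.ramsey_amalgam hHJ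

end Amalgamation

theorem exists_picture {K V C : Type} [Finite K] [Finite V] [Finite C] [Nonempty C]
    (hK : 3 ≤ ENat.card K) {ℰ : Set (Set V)} (hℰ : IsLinearHypergraph ℰ) :
    ∃ (κ : Type) (_ : Finite κ) (Lab : (κ → K) → V → Prop), IsPicture ℰ C Set.univ Lab := by
  refine Set.Finite.induction_to_univ (C := fun S => ∃ (κ : Type) (_ : Finite κ)
    (Lab : (κ → K) → V → Prop), IsPicture ℰ C S Lab) ∅ (exists_base_picture hK ℰ C) ?_
  rintro S hS ⟨κ, _, Lab, hP⟩
  obtain ⟨v, hv⟩ := (Set.ne_univ_iff_exists_notMem S).mp hS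
  obtain ⟨ι, _, 𝒲, h𝒲, hHJ⟩ := exists_unionFree_halesJewett {w // Lab w v} C
  exact ⟨v, hv, ι × κ, inferInstance, amalgam Lab v 𝒲, hP.amalgam hK hℰ h𝒲 hHJ⟩

section Ramsey

open Filter

theorem exists_eventually_eq {α C : Type*} [Finite C] (U : Ultrafilter α) (c : α → C) :
    ∃ j, ∀ᶠ x in U, c x = j := by
  obtain ⟨j, hj⟩ := (U.map c).eq_pure_of_finite
  have hmem : {j} ∈ U.map c := hj ▸ Set.mem_singleton j
  exact ⟨j, hmem⟩

theorem exists_monochromatic_powersetCard_nat {C : Type*} [Finite C] (m l : ℕ)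
    (c : Finset ℕ → C) :
    ∃ B : Finset ℕ, B.card = l ∧ ∃ j, ∀ S ∈ B.powersetCard m, c S = j := by
  choose lim hlim using fun (d : Finset ℕ → C) S =>
    exists_eventually_eq (hyperfilter ℕ) fun x => d (insert x S)
  -- `lim^[i] c S` is the colour of `S` together with `i` further points, each of them generic
  -- over the preceding ones.
  have hiter (i : ℕ) (S : Finset ℕ) :
      ∀ᶠ x in hyperfilter ℕ, lim^[i] c (insert x S) = lim^[i + 1] c S := by
    simpa only [Function.iterate_succ_apply'] using hlim (lim^[i] c) S
  suffices ∃ B : Finset ℕ, B.card = l ∧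
      ∀ S ⊆ B, ∀ i, i + S.card = m → lim^[i] c S = lim^[m] c ∅ by
    obtain ⟨B, hB, h⟩ := this
    exact ⟨B, hB, _, fun S hS =>
      h S (Finset.mem_powersetCard.mp hS).1 0 (by simp [(Finset.mem_powersetCard.mp hS).2])⟩
  induction l with
  | zero =>
    refine ⟨∅, rfl, fun S hS i hi => ?_⟩
    obtain rfl := Finset.subset_empty.mp hS
    rw [← hi, Finset.card_empty, add_zero]
  | succ l ih =>
    obtain ⟨B, hB, h⟩ := ih
    have hgeneric : ∀ᶠ x in hyperfilter ℕ, ∀ S ∈ B.powerset, ∀ i ∈ Finset.range m,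
        lim^[i] c (insert x S) = lim^[i + 1] c S := by
      simp only [eventually_all_finset]
      exact fun S _ i _ => hiter i S
    have hnew : ∀ᶠ x in hyperfilter ℕ, x ∉ B :=
      hyperfilter_le_cofinite B.finite_toSet.compl_mem_cofinite
    obtain ⟨x, hx, hxB⟩ := (hgeneric.and hnew).exists
    refine ⟨insert x B, by rw [Finset.card_insert_of_notMem hxB, hB], fun S hS i hi => ?_⟩
    by_cases hxS : x ∈ S
    · have hsub : S.erase x ⊆ B := Finset.subset_insert_iff.mp hS
      have hcard := Finset.card_erase_add_one hxS
      rw [← Finset.insert_erase hxS, hx _ (Finset.mem_powerset.mpr hsub) i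
        (Finset.mem_range.mpr (by omega))]
      exact h _ hsub _ (by omega)
    · exact h S ((Finset.subset_insert_iff_of_notMem hxS).mp hS) i hi

theorem exists_monochromatic_powersetCard_fin (C : Type*) [Finite C] (m l : ℕ) :
    ∃ n, ∀ c : Finset (Fin n) → C, ∃ B : Finset (Fin n), B.card = l ∧
      ∃ j, ∀ S ∈ B.powersetCard m, c S = j := by
  by_contra! h
  choose c hc using h
  choose lim hlim using fun S : Finset ℕ =>
    exists_eventually_eq (hyperfilter ℕ) fun n =>
      c n (S.preimage Fin.valEmbedding Fin.valEmbedding.injective.injOn)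
  obtain ⟨B, hB, j, hj⟩ := exists_monochromatic_powersetCard_nat m l lim
  have hcol : ∀ᶠ n in hyperfilter ℕ, ∀ S ∈ B.powerset,
      c n (S.preimage Fin.valEmbedding Fin.valEmbedding.injective.injOn) = lim S := by
    simp only [eventually_all_finset]
    exact fun S _ => hlim S
  have hlt : ∀ᶠ n in hyperfilter ℕ, ∀ x ∈ B, x < n := by
    simp only [eventually_all_finset]
    exact fun x _ => Nat.hyperfilter_le_atTop (eventually_gt_atTop x)
  obtain ⟨n, hcol, hlt⟩ := (hcol.and hlt).exists
  obtain ⟨S, hS, hne⟩ := hc n (B.attachFin hlt) ((Finset.card_attachFin B hlt).trans hB) j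
  obtain ⟨hsub, hcard⟩ := Finset.mem_powersetCard.mp hS
  have hmap : S.map Fin.valEmbedding ⊆ B := by
    simpa [Finset.subset_iff] using hsub
  apply hne
  rw [← hj _ (Finset.mem_powersetCard.mpr ⟨hmap, by rw [Finset.card_map, hcard]⟩),
    ← hcol _ (Finset.mem_powerset.mpr hmap), Finset.preimage_map]

end Ramsey

section Rank

variable {α : Type*} [LinearOrder α]

/-- The number of elements of `S` below `x`, which for `x ∈ S` is the position of `x` in the
increasing enumeration of `S`, counted from `0`. -/
def rankIn (S : Finset α) (x : α) : ℕ := {y ∈ S | y < x}.card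

theorem rankIn_lt_rankIn {S : Finset α} {x y : α} (hx : x ∈ S) (hxy : x < y) :
    rankIn S x < rankIn S y := by
  refine Finset.card_lt_card (Finset.ssubset_iff_of_subset ?_ |>.mpr ⟨x, ?_, ?_⟩)
  · exact Finset.monotone_filter_right S fun z _ hz => hz.trans hxy
  · exact Finset.mem_filter.mpr ⟨hx, hxy⟩
  · simp

theorem rankIn_lt_rankIn_iff {S : Finset α} {x y : α} (hx : x ∈ S) (hy : y ∈ S) :
    rankIn S x < rankIn S y ↔ x < y := by
  refine ⟨fun h => ?_, rankIn_lt_rankIn hx⟩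
  by_contra! hyx
  rcases hyx.eq_or_lt with rfl | hlt
  · exact h.false
  · exact h.asymm (rankIn_lt_rankIn hy hlt)

theorem rankIn_injOn (S : Finset α) : Set.InjOn (rankIn S) S := by
  intro x hx y hy hxy
  by_contra hne
  rcases lt_or_gt_of_ne hne with h | h
  · exact (rankIn_lt_rankIn hx h).ne hxy
  · exact (rankIn_lt_rankIn hy h).ne' hxy

theorem image_rankIn (S : Finset α) : S.image (rankIn S) = Finset.range S.card := by
  refine Finset.eq_of_subset_of_card_le (Finset.image_subset_iff.mpr fun x hx => ?_) ?_
  · exact Finset.mem_range.mpr (Finset.card_lt_card (Finset.filter_ssubset.mpr ⟨x, hx, by simp⟩))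
  · rw [Finset.card_range, Finset.card_image_of_injOn (rankIn_injOn S)]

theorem exists_rankIn_eq {S : Finset α} {i : ℕ} (hi : i < S.card) : ∃ x ∈ S, rankIn S x = i :=
  Finset.mem_image.mp (image_rankIn S ▸ Finset.mem_range.mpr hi)

theorem rankIn_eq_rankIn_erase_add {S : Finset α} {c : α} (hc : c ∈ S) (x : α) :
    rankIn S x = rankIn (S.erase c) x + if c < x then 1 else 0 := by
  unfold rankIn
  rw [Finset.filter_erase]
  split_ifs with hcx
  · rw [Finset.card_erase_add_one (Finset.mem_filter.mpr ⟨hc, hcx⟩)]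
  · rw [Finset.erase_eq_of_notMem (a := c) (by simp [hcx]), add_zero]

/-- The `s` elements of `S` at the positions `i, …, i + s - 1`. -/
def window (S : Finset α) (i s : ℕ) : Finset α :=
  {x ∈ S | rankIn S x ∈ Finset.Ico i (i + s)}

theorem mem_window {S : Finset α} {i s : ℕ} {x : α} :
    x ∈ window S i s ↔ x ∈ S ∧ i ≤ rankIn S x ∧ rankIn S x < i + s := by
  simp [window]

theorem card_window {S : Finset α} {i s : ℕ} (h : i + s ≤ S.card) : (window S i s).card = s := by
  have hinj : Set.InjOn (rankIn S) (window S i s) :=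
    (rankIn_injOn S).mono fun x hx => (Finset.mem_filter.mp hx).1
  have himage : (window S i s).image (rankIn S) = Finset.Ico i (i + s) := by
    rw [window, ← Finset.filter_image (p := (· ∈ Finset.Ico i (i + s))), image_rankIn]
    ext k
    simp only [Finset.mem_filter, Finset.mem_range, Finset.mem_Ico]
    omega
  rw [← Finset.card_image_of_injOn hinj, himage, Nat.card_Ico, Nat.add_sub_cancel_left]

end Rank

section DeletionHypergraph

variable {α : Type*} [LinearOrder α] {l s : ℕ}

/-- The points `c 0 < c 1 < ⋯ < c l` split the other `l * s` elements of `B` into runs of `s - 1`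
(the points themselves occupying the positions `0, s, …, l * s`). -/
structure IsCut (s : ℕ) (B : Finset α) (c : Fin (l + 1) → α) : Prop where
  card_eq : B.card = l * s + 1
  mem : ∀ a, c a ∈ B
  rankIn_eq : ∀ a, rankIn B (c a) = a * s

/-- The edges are the sets of the `l + 1` vertices obtained from a set of size `l * s + 1` by
deleting one of the elements at the positions `0, s, …, l * s`. -/
def deletionHypergraph (α : Type*) [LinearOrder α] (l s : ℕ) : Set (Set (Finset α)) :=
  {e | ∃ (B : Finset α) (c : Fin (l + 1) → α), IsCut s B c ∧ e = Set.range fun a => B.erase (c a)}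

theorem exists_isCut {B : Finset α} (hB : B.card = l * s + 1) :
    ∃ c : Fin (l + 1) → α, IsCut s B c := by
  have hlt (a : Fin (l + 1)) : a * s < B.card := by
    have := Nat.mul_le_mul_right s (Nat.lt_succ_iff.mp a.isLt)
    omega
  choose c hc hrank using fun a => exists_rankIn_eq (hlt a)
  exact ⟨c, hB, hc, hrank⟩

theorem IsCut.card_erase {B : Finset α} {c : Fin (l + 1) → α} (h : IsCut s B c)
    (a : Fin (l + 1)) : (B.erase (c a)).card = l * s := by
  rw [Finset.card_erase_of_mem (h.mem a), h.card_eq, Nat.add_sub_cancel]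

theorem IsCut.unique {B : Finset α} {c c' : Fin (l + 1) → α} (h : IsCut s B c)
    (h' : IsCut s B c') : c = c' :=
  funext fun a => rankIn_injOn B (h.mem a) (h'.mem a) ((h.rankIn_eq a).trans (h'.rankIn_eq a).symm)

theorem IsCut.injective_erase {B : Finset α} {c : Fin (l + 1) → α} (h : IsCut s B c) (hs : 0 < s) :
    Function.Injective fun a => B.erase (c a) := by
  intro a a' haa
  have hc : c a = c a' := Finset.erase_injOn B (h.mem a) (h.mem a') haa
  have hrank := h.rankIn_eq a
  rw [hc, h.rankIn_eq] at hrank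
  exact Fin.ext (Nat.eq_of_mul_eq_mul_right hs hrank.symm)

theorem erase_union_erase {B : Finset α} {x y : α} (h : B.erase x ≠ B.erase y) :
    B.erase x ∪ B.erase y = B := by
  have hxy : x ≠ y := fun hxy => h (hxy ▸ rfl)
  ext z
  simp only [Finset.mem_union, Finset.mem_erase]
  grind

theorem isLinearHypergraph_deletionHypergraph :
    IsLinearHypergraph (deletionHypergraph α l s) := by
  rintro _ ⟨B, c, h, rfl⟩ _ ⟨B', c', h', rfl⟩ hne S ⟨⟨a, ha⟩, ⟨a', ha'⟩⟩ T ⟨⟨b, hb⟩, ⟨b', hb'⟩⟩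
  by_contra hST
  have hB : S ∪ T = B := by
    rw [← ha, ← hb]
    exact erase_union_erase fun hab => hST (ha.symm.trans (hab.trans hb))
  have hB' : S ∪ T = B' := by
    rw [← ha', ← hb']
    exact erase_union_erase fun hab => hST (ha'.symm.trans (hab.trans hb'))
  obtain rfl := hB.symm.trans hB'
  exact hne (h.unique h' ▸ rfl)

theorem exists_monochromatic_deletionHypergraph (C : Type*) [Finite C] (l : ℕ) {s : ℕ}
    (hs : 0 < s) :
    ∃ n, ∀ χ : Finset (Fin n) → C, ∃ e : Fin (l + 1) → Finset (Fin n),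
      IsEdgeTuple (deletionHypergraph (Fin n) l s) e ∧ ∃ j, ∀ a, χ (e a) = j := by
  obtain ⟨n, hn⟩ := exists_monochromatic_powersetCard_fin C (l * s) (l * s + 1)
  refine ⟨n, fun χ => ?_⟩
  obtain ⟨B, hB, j, hj⟩ := hn χ
  obtain ⟨c, hc⟩ := exists_isCut hB
  exact ⟨fun a => B.erase (c a), ⟨hc.injective_erase hs, B, c, hc, rfl⟩, j, fun a =>
    hj _ (Finset.mem_powersetCard.mpr ⟨Finset.erase_subset _ _, hc.card_erase a⟩)⟩

end DeletionHypergraph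

section InnerMin

variable {α : Type*} [LinearOrder α] {l s i : ℕ} {B S : Finset α} {c : Fin (l + 1) → α}

/-- The permutation `h` is minimized on the window of `S` of length `s` starting at `i` by the
element `z`, which is neither the first nor the last one of the window. -/
structure IsInnerMin (h : Equiv.Perm α) (S : Finset α) (i s : ℕ) (z : α) : Prop where
  mem : z ∈ window S i s
  le : ∀ x ∈ window S i s, h z ≤ h x
  ne_first : rankIn S z ≠ i
  ne_last : rankIn S z + 1 ≠ i + s

theorem IsInnerMin.mem_of_erase {h : Equiv.Perm α} {x z : α}
    (hz : IsInnerMin h (B.erase x) i s z) : z ∈ B :=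
  Finset.mem_of_mem_erase (mem_window.mp hz.mem).1

theorem IsInnerMin.rankIn_mem_of_erase {h : Equiv.Perm α} {x z : α} (hx : x ∈ B)
    (hz : IsInnerMin h (B.erase x) i s z) : rankIn B z ∈ Set.Ioo i (i + s) := by
  obtain ⟨-, hlo, hhi⟩ := mem_window.mp hz.mem
  have hfirst := hz.ne_first
  have hlast := hz.ne_last
  rw [rankIn_eq_rankIn_erase_add hx, Set.mem_Ioo]
  split_ifs <;> omega

theorem IsCut.rankIn_eq_rankIn_erase_add (hc : IsCut s B c) {x : α} (hx : x ∈ B) {j : ℕ}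
    (hrank : rankIn B x ∈ Set.Ioo (j * s) (j * s + s)) (a : Fin (l + 1)) :
    rankIn B x = rankIn (B.erase (c a)) x + if a.val ≤ j then 1 else 0 := by
  have hiff : c a < x ↔ a.val ≤ j := by
    rw [← rankIn_lt_rankIn_iff (hc.mem a) hx, hc.rankIn_eq]
    constructor
    · intro h
      have hlt : a * s < (j + 1) * s := (h.trans hrank.2).trans_eq (Nat.succ_mul j s).symm
      exact Nat.lt_succ_iff.mp (Nat.lt_of_mul_lt_mul_right hlt)
    · intro h
      exact (Nat.mul_le_mul_right s h).trans_lt hrank.1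
  rw [_root_.rankIn_eq_rankIn_erase_add (hc.mem a) x]
  simp only [hiff]

theorem IsCut.mem_window_erase (hc : IsCut s B c) {x : α} (hx : x ∈ B) {j : ℕ}
    (hrank : rankIn B x ∈ Set.Ioo (j * s) (j * s + s)) (a : Fin (l + 1)) :
    x ∈ window (B.erase (c a)) (j * s) s := by
  have hne : x ≠ c a := by
    rintro rfl
    rw [hc.rankIn_eq, ← Nat.succ_mul] at hrank
    exact (Nat.lt_of_mul_lt_mul_right hrank.1).not_ge
      (Nat.lt_succ_iff.mp (Nat.lt_of_mul_lt_mul_right hrank.2))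
  have herase := hc.rankIn_eq_rankIn_erase_add hx hrank a
  rw [Set.mem_Ioo] at hrank
  refine mem_window.mpr ⟨Finset.mem_erase.mpr ⟨hne, hx⟩, ?_, ?_⟩ <;>
    split_ifs at herase <;> omega

theorem IsCut.innerMin_unique (hc : IsCut s B c) {h : Equiv.Perm α} {j : ℕ} {a a' : Fin (l + 1)}
    {z z' : α} (hz : IsInnerMin h (B.erase (c a)) (j * s) s z)
    (hz' : IsInnerMin h (B.erase (c a')) (j * s) s z') : z = z' := by
  have hmem := hc.mem_window_erase hz.mem_of_erase (hz.rankIn_mem_of_erase (hc.mem a)) a'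
  have hmem' := hc.mem_window_erase hz'.mem_of_erase (hz'.rankIn_mem_of_erase (hc.mem a')) a
  exact h.injective (le_antisymm (hz.le _ hmem') (hz'.le _ hmem))

theorem card_filter_le_val_add {l a : ℕ} (ha : a ≤ l) :
    Finset.card {j : Fin l | a ≤ j.val} + a = l := by
  have hsplit :=
    Finset.card_filter_add_card_filter_not (s := Finset.univ) fun j : Fin l => a ≤ j.val
  simpa only [not_le, Fin.card_filter_val_lt, min_eq_right ha, Finset.card_univ,
    Fintype.card_fin] using hsplit

theorem IsCut.sum_rankIn_add (hc : IsCut s B c) {z : Fin l → α} (hz : ∀ j, z j ∈ B)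
    (hrank : ∀ j : Fin l, rankIn B (z j) ∈ Set.Ioo (j * s) (j * s + s)) (a : Fin (l + 1)) :
    ∑ j, rankIn B (z j) + a = ∑ j, rankIn (B.erase (c a)) (z j) + l := by
  have hsum : ∑ j, rankIn B (z j) =
      ∑ j, rankIn (B.erase (c a)) (z j) + Finset.card {j : Fin l | a.val ≤ j.val} := by
    rw [Finset.card_filter, ← Finset.sum_add_distrib]
    exact Finset.sum_congr rfl fun j _ => hc.rankIn_eq_rankIn_erase_add (hz j) (hrank j) a
  rw [hsum, add_assoc, card_filter_le_val_add (Nat.lt_succ_iff.mp a.isLt)]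

/-- The sets in each of whose windows of length `s` starting at `0, s, …, (l - 1) * s` the
permutation `h` is minimized by an inner element, with the positions of these elements not adding
up to `θ`. For random `h` and `θ` it is a random independent set in the hypergraph of deletions, in
which the sets of any size other than `l * s` are isolated vertices. -/
def independentDeletions (l s : ℕ) (h : Equiv.Perm α) (θ : ZMod (l + 1)) : Set (Finset α) :=
  {S | S.card = l * s → ∃ z : Fin l → α,
    (∀ j : Fin l, IsInnerMin h S (j * s) s (z j)) ∧ ∑ j, (rankIn S (z j) : ZMod (l + 1)) ≠ θ}

theorem not_subset_independentDeletions {e : Set (Finset α)} (he : e ∈ deletionHypergraph α l s)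
    (h : Equiv.Perm α) (θ : ZMod (l + 1)) : ¬ e ⊆ independentDeletions l s h θ := by
  obtain ⟨B, c, hc, rfl⟩ := he
  intro hsub
  choose z hz hsum using fun a => hsub ⟨a, rfl⟩ (hc.card_erase a)
  have hz_eq (a : Fin (l + 1)) : z a = z 0 := funext fun j => hc.innerMin_unique (hz a j) (hz 0 j)
  -- Deleting `c a` lowers the positions of exactly `l - a` of the common minima by one, so the
  -- sums of the positions run over all residues.
  have hresidue (t : ZMod (l + 1)) : ∃ a : Fin (l + 1), ((a : ℕ) : ZMod (l + 1)) = t :=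
    ⟨⟨t.val, t.val_lt⟩, ZMod.natCast_zmod_val t⟩
  obtain ⟨a, ha⟩ := hresidue (θ - ∑ j, (rankIn B (z 0 j) : ZMod (l + 1)) + l)
  have hshift := congrArg (Nat.cast (R := ZMod (l + 1))) <| hc.sum_rankIn_add
    (fun j => (hz 0 j).mem_of_erase) (fun j => (hz 0 j).rankIn_mem_of_erase (hc.mem 0)) a
  push_cast at hshift
  apply hsum a
  rw [hz_eq a]
  linear_combination ha - hshift

end InnerMin

section Counting

variable {α : Type*} [LinearOrder α] [Fintype α]

theorem card_perm_minimized_eq {W : Finset α} {x y : α} (hx : x ∈ W) (hy : y ∈ W) :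
    Finset.card {h : Equiv.Perm α | ∀ w ∈ W, h y ≤ h w} =
      Finset.card {h : Equiv.Perm α | ∀ w ∈ W, h x ≤ h w} := by
  have hswap {w : α} : Equiv.swap x y w ∈ W ↔ w ∈ W := by
    rw [Equiv.swap_apply_def]
    split_ifs <;> simp_all
  refine Finset.card_equiv (Equiv.mulRight (Equiv.swap x y)) fun h => ?_
  simp only [Finset.mem_filter_univ, Equiv.coe_mulRight, Equiv.Perm.mul_apply,
    Equiv.swap_apply_left]
  rw [(Equiv.swap x y).forall_congr_left]
  simp only [Equiv.symm_swap, hswap]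

theorem card_perm_minimized_mul_card {W : Finset α} {x : α} (hx : x ∈ W) :
    Finset.card {h : Equiv.Perm α | ∀ w ∈ W, h x ≤ h w} * W.card =
      (Fintype.card α).factorial := by
  have hunique (h : Equiv.Perm α) : {y ∈ W | ∀ w ∈ W, h y ≤ h w}.card = 1 := by
    obtain ⟨y, hy, hmin⟩ := W.exists_min_image h ⟨x, hx⟩
    refine Finset.card_eq_one.mpr ⟨y, Finset.eq_singleton_iff_unique_mem.mpr
      ⟨Finset.mem_filter.mpr ⟨hy, hmin⟩, fun y' hy' => ?_⟩⟩
    rw [Finset.mem_filter] at hy'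
    exact h.injective (le_antisymm (hy'.2 y hy) (hmin y' hy'.1))
  have hcount := Finset.sum_card_bipartiteAbove_eq_sum_card_bipartiteBelow
    (s := W) (t := (Finset.univ : Finset (Equiv.Perm α))) fun y h => ∀ w ∈ W, h y ≤ h w
  simp only [Finset.bipartiteAbove, Finset.bipartiteBelow, hunique] at hcount
  rw [Finset.sum_congr rfl fun y hy => card_perm_minimized_eq hx hy] at hcount
  simpa [mul_comm, Fintype.card_perm] using hcount

open Classical in
theorem card_perm_not_exists_isInnerMin_mul_le {S : Finset α} {i s : ℕ} (hi : i + s ≤ S.card) :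
    Finset.card {h : Equiv.Perm α | ¬ ∃ z, IsInnerMin h S i s z} * s ≤
      2 * (Fintype.card α).factorial := by
  rcases s.eq_zero_or_pos with rfl | hs
  · simp
  let ends : Finset α := {x ∈ window S i s | rankIn S x = i ∨ rankIn S x + 1 = i + s}
  have hends : ends.card ≤ 2 := by
    refine (Finset.card_le_card_of_injOn (t := {i, i + s - 1}) (rankIn S) ?_ ?_).trans
      Finset.card_le_two
    · intro x hx
      have := (Finset.mem_filter.mp hx).2
      simp only [Finset.coe_insert, Finset.coe_singleton, Set.mem_insert_iff,
        Set.mem_singleton_iff]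
      omega
    · exact (rankIn_injOn S).mono fun x hx => (mem_window.mp (Finset.mem_filter.mp hx).1).1
  have hcover : ({h : Equiv.Perm α | ¬ ∃ z, IsInnerMin h S i s z} : Finset (Equiv.Perm α)) ⊆
      ends.biUnion fun x => {h | ∀ w ∈ window S i s, h x ≤ h w} := by
    intro h hh
    have hne : (window S i s).Nonempty := by
      rwa [← Finset.card_pos, card_window hi]
    obtain ⟨x, hx, hmin⟩ := (window S i s).exists_min_image h hne
    refine Finset.mem_biUnion.mpr ⟨x, Finset.mem_filter.mpr ⟨hx, ?_⟩, by simpa using hmin⟩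
    by_contra! hinner
    exact (Finset.mem_filter.mp hh).2 ⟨x, hx, hmin, hinner.1, hinner.2⟩
  calc _ ≤ (∑ x ∈ ends, Finset.card {h : Equiv.Perm α | ∀ w ∈ window S i s, h x ≤ h w}) * s :=
        Nat.mul_le_mul_right s ((Finset.card_le_card hcover).trans Finset.card_biUnion_le)
    _ = ∑ _x ∈ ends, (Fintype.card α).factorial := by
        rw [Finset.sum_mul]
        refine Finset.sum_congr rfl fun x hx => ?_
        have hwindow := card_perm_minimized_mul_card (Finset.mem_filter.mp hx).1
        rwa [card_window hi] at hwindow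
    _ ≤ 2 * (Fintype.card α).factorial := by
        rw [Finset.sum_const, smul_eq_mul]
        exact Nat.mul_le_mul_right _ hends

open Classical in
theorem le_card_perm_forall_exists_isInnerMin {S : Finset α} {l s : ℕ} (hS : S.card = l * s) :
    (Fintype.card α).factorial * s ≤
      Finset.card {h : Equiv.Perm α | ∀ j : Fin l, ∃ z, IsInnerMin h S (j * s) s z} * s +
        2 * l * (Fintype.card α).factorial := by
  let bad (j : Fin l) : Finset (Equiv.Perm α) := {h | ¬ ∃ z, IsInnerMin h S (j * s) s z}
  have hcover : (Finset.univ : Finset (Equiv.Perm α)) ⊆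
      ({h | ∀ j : Fin l, ∃ z, IsInnerMin h S (j * s) s z} : Finset (Equiv.Perm α)) ∪
        Finset.univ.biUnion bad := by
    intro h _
    simp only [bad, Finset.mem_union, Finset.mem_filter_univ, Finset.mem_biUnion,
      Finset.mem_univ, true_and, ← not_forall]
    exact Classical.em _
  have hbad : (∑ j, (bad j).card) * s ≤ 2 * l * (Fintype.card α).factorial := by
    rw [Finset.sum_mul]
    refine (Finset.sum_le_card_nsmul _ _ (2 * (Fintype.card α).factorial) fun j _ =>
      card_perm_not_exists_isInnerMin_mul_le ?_).trans_eq ?_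
    · rw [hS, ← Nat.succ_mul]
      exact Nat.mul_le_mul_right s j.isLt
    · rw [Finset.card_univ, Fintype.card_fin, smul_eq_mul]
      ring
  have hcard := (Finset.card_le_card hcover).trans
    ((Finset.card_union_le _ _).trans (Nat.add_le_add_left Finset.card_biUnion_le _))
  rw [Finset.card_univ, Fintype.card_perm] at hcard
  calc _ ≤ _ := Nat.mul_le_mul_right s hcard
    _ ≤ _ := by
      rw [add_mul]
      exact Nat.add_le_add_left hbad _

end Counting

section FractionalIndependence

/-- Some nonempty finite family of vertex sets containing no edge of `ℰ` covers every vertex with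
at least the proportion `μ` of its members. -/
def IsFractionallyIndependent {V : Type*} (ℰ : Set (Set V)) (μ : ℝ) : Prop :=
  ∃ (Ω : Type) (_ : Finite Ω) (_ : Nonempty Ω) (I : Ω → Set V),
    (∀ ω, ∀ e ∈ ℰ, ¬ e ⊆ I ω) ∧ ∀ v, μ * Nat.card Ω ≤ Nat.card {ω // v ∈ I ω}

theorem IsFractionallyIndependent.exists_large {V β : Type*} {ℰ : Set (Set V)} {μ : ℝ}
    (hμ : IsFractionallyIndependent ℰ μ) (Y : Finset β) (lab : β → V) :
    ∃ Z ⊆ Y, (∀ e ∈ ℰ, ¬ e ⊆ lab '' Z) ∧ μ * Y.card ≤ Z.card := by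
  classical
  obtain ⟨Ω, _, _, I, hI, hcover⟩ := hμ
  have := Fintype.ofFinite Ω
  simp only [Nat.card_eq_fintype_card, Fintype.card_subtype] at hcover
  suffices ∃ ω : Ω, μ * Y.card ≤ Finset.card {y ∈ Y | lab y ∈ I ω} by
    obtain ⟨ω, hω⟩ := this
    refine ⟨{y ∈ Y | lab y ∈ I ω}, Finset.filter_subset _ _, fun e he hsub => hI ω e he ?_, hω⟩
    intro v hv
    obtain ⟨y, hy, rfl⟩ := hsub hv
    exact (Finset.mem_filter.mp hy).2
  have hcount := Finset.sum_card_bipartiteAbove_eq_sum_card_bipartiteBelow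
    (s := (Finset.univ : Finset Ω)) (t := Y) fun ω y => lab y ∈ I ω
  have hsum : ∑ _ω : Ω, μ * Y.card ≤ ∑ ω : Ω, (Finset.card {y ∈ Y | lab y ∈ I ω} : ℝ) := by
    calc ∑ _ω : Ω, μ * Y.card = ∑ _y ∈ Y, μ * Fintype.card Ω := by
          simp only [Finset.sum_const, Finset.card_univ, nsmul_eq_mul]
          ring
      _ ≤ ∑ y ∈ Y, (Finset.card {ω | lab y ∈ I ω} : ℝ) :=
          Finset.sum_le_sum fun y _ => hcover (lab y)
      _ = ∑ ω : Ω, (Finset.card {y ∈ Y | lab y ∈ I ω} : ℝ) := mod_cast hcount.symm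
  obtain ⟨ω, -, hω⟩ := Finset.exists_le_of_sum_le Finset.univ_nonempty hsum
  exact ⟨ω, hω⟩

variable {α : Type*} [LinearOrder α] [Fintype α] {l s : ℕ}

open Classical in
theorem card_mul_le_card_mem_independentDeletions (S : Finset α) :
    Finset.card {h : Equiv.Perm α | ∀ j : Fin l, ∃ z, IsInnerMin h S (j * s) s z} * l ≤
      Finset.card {ω : Equiv.Perm α × ZMod (l + 1) | S ∈ independentDeletions l s ω.1 ω.2} := by
  have hsum (h : Equiv.Perm α) : ∃ t : ZMod (l + 1),
      (∀ j : Fin l, ∃ z, IsInnerMin h S (j * s) s z) → ∃ z : Fin l → α,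
        (∀ j : Fin l, IsInnerMin h S (j * s) s (z j)) ∧
          ∑ j, (rankIn S (z j) : ZMod (l + 1)) = t := by
    by_cases hh : ∀ j : Fin l, ∃ z, IsInnerMin h S (j * s) s z
    · choose z hz using hh
      exact ⟨_, fun _ => ⟨z, hz, rfl⟩⟩
    · exact ⟨0, fun hh' => absurd hh' hh⟩
  choose t ht using hsum
  have hcard : (Finset.univ.erase (0 : ZMod (l + 1))).card = l := by
    rw [Finset.card_erase_of_mem (Finset.mem_univ _), Finset.card_univ, ZMod.card,
      Nat.add_sub_cancel]
  refine (congrArg _ hcard.symm).trans_le ?_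
  rw [← Finset.card_product]
  refine Finset.card_le_card_of_injOn (fun ω => (ω.1, t ω.1 - ω.2)) ?_ ?_
  · rintro ⟨h, θ⟩ hω
    simp only [Finset.coe_product, Set.mem_prod, Finset.mem_coe, Finset.mem_filter_univ,
      Finset.mem_erase] at hω ⊢
    obtain ⟨z, hz, hzt⟩ := ht h hω.1
    exact fun _ => ⟨z, hz, by rw [hzt, ne_eq, eq_sub_iff_add_eq, add_eq_left]; exact hω.2.1⟩
  · rintro ⟨h, θ⟩ - ⟨h', θ'⟩ - heq
    obtain ⟨rfl, hθ⟩ := Prod.mk.injEq _ _ _ _ ▸ heq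
    exact Prod.ext rfl (sub_right_injective hθ)

theorem isFractionallyIndependent_deletionHypergraph {α : Type} [LinearOrder α] [Finite α]
    {l s : ℕ} (hs : 0 < s) {μ : ℝ} (hμ : 2 * l ^ 2 ≤ (l - μ * (l + 1)) * s) :
    IsFractionallyIndependent (deletionHypergraph α l s) μ := by
  classical
  have := Fintype.ofFinite α
  refine ⟨Equiv.Perm α × ZMod (l + 1), inferInstance, inferInstance,
    fun ω => independentDeletions l s ω.1 ω.2,
    fun ω e he => not_subset_independentDeletions he ω.1 ω.2, fun S => ?_⟩
  rw [Nat.card_prod, Nat.card_perm, Nat.card_zmod, Nat.card_eq_fintype_card,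
    Nat.card_eq_fintype_card, Fintype.card_subtype]
  have hs' : (0 : ℝ) < s := Nat.cast_pos.mpr hs
  by_cases hS : S.card = l * s
  · have hgood : ((Fintype.card α).factorial * s : ℝ) ≤
        Finset.card {h : Equiv.Perm α | ∀ j : Fin l, ∃ z, IsInnerMin h S (j * s) s z} * s +
          2 * l * (Fintype.card α).factorial := mod_cast le_card_perm_forall_exists_isInnerMin hS
    have hpairs : (Finset.card {h : Equiv.Perm α | ∀ j : Fin l, ∃ z, IsInnerMin h S (j * s) s z} *
        l : ℝ) ≤ Finset.card {ω : Equiv.Perm α × ZMod (l + 1) |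
          S ∈ independentDeletions l s ω.1 ω.2} :=
      mod_cast card_mul_le_card_mem_independentDeletions S
    refine le_trans (le_of_mul_le_mul_right ?_ hs') hpairs
    push_cast
    linear_combination ((Fintype.card α).factorial : ℝ) * hμ + (l : ℝ) * hgood
  · have hmem (ω : Equiv.Perm α × ZMod (l + 1)) : S ∈ independentDeletions l s ω.1 ω.2 :=
      fun h => absurd h hS
    have hμ₁ : 0 ≤ l - μ * (l + 1) :=
      nonneg_of_mul_nonneg_left ((by positivity : (0 : ℝ) ≤ 2 * l ^ 2).trans hμ) hs'
    simp only [hmem, Finset.filter_true, Finset.card_univ, Fintype.card_prod, Fintype.card_perm,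
      ZMod.card]
    exact mul_le_of_le_one_left (by positivity) (by nlinarith)

theorem exists_hypergraph {l : ℕ} {μ : ℝ} (hμ : μ < l / (l + 1)) (C : Type*) [Finite C] :
    ∃ (V : Type) (_ : Finite V) (ℰ : Set (Set V)), IsLinearHypergraph ℰ ∧
      IsFractionallyIndependent ℰ μ ∧
      ∀ χ : V → C, ∃ e : Fin (l + 1) → V, IsEdgeTuple ℰ e ∧ ∃ j, ∀ a, χ (e a) = j := by
  have hδ : 0 < l - μ * (l + 1) := sub_pos.mpr ((lt_div_iff₀ (by positivity)).mp hμ)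
  obtain ⟨s, hs⟩ := exists_nat_gt (2 * l ^ 2 / (l - μ * (l + 1)))
  have hs₀ : 0 < s := Nat.cast_pos.mp ((by positivity : (0 : ℝ) ≤ _).trans_lt hs)
  obtain ⟨n, hn⟩ := exists_monochromatic_deletionHypergraph C l hs₀
  exact ⟨Finset (Fin n), inferInstance, deletionHypergraph (Fin n) l s,
    isLinearHypergraph_deletionHypergraph, isFractionallyIndependent_deletionHypergraph hs₀
      ((div_lt_iff₀' hδ).mp hs).le, hn⟩

end FractionalIndependence

section GenericProjection

variable {d : ℕ}

/-- The squared Euclidean distance of two lattice points, which is an integer. -/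
def sqDist (a b : Fin d → ℤ) : ℤ := (a - b) ⬝ᵥ (a - b)

theorem sqDist_eq_zero {a b : Fin d → ℤ} : sqDist a b = 0 ↔ a = b := by
  rw [sqDist, dotProduct_self_eq_zero, sub_eq_zero]

theorem sqDist_self (a : Fin d → ℤ) : sqDist a a = 0 := sqDist_eq_zero.mpr rfl

theorem dist_latticePoint_sq (a b : Fin d → ℤ) :
    dist (latticePoint a) (latticePoint b) ^ 2 = sqDist a b := by
  rw [EuclideanSpace.dist_eq, Real.sq_sqrt (by positivity)]
  simp [latticePoint, sqDist, dotProduct, Real.dist_eq, sq]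

theorem sq_mul_sqDist_of_congruent {ι : Type*} {a b : ι → Fin d → ℤ} {t : ℝ}
    (h : Congruent (fun i => t • latticePoint (a i)) fun i => latticePoint (b i)) (i j : ι) :
    t ^ 2 * sqDist (a i) (a j) = sqDist (b i) (b j) := by
  rw [← dist_latticePoint_sq, ← dist_latticePoint_sq, ← congruent_iff_dist_eq.mp h i j,
    dist_smul₀, mul_pow, Real.norm_eq_abs, sq_abs]

/-- All distances between the points `b i` are the same multiple of those between the points
`a i`; the multiple is allowed to vanish. -/
def IsWeakSimilarity {ι : Type*} (a b : ι → Fin d → ℤ) : Prop :=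
  ∀ i i' j j', sqDist (a j) (a j') * sqDist (b i) (b i') =
    sqDist (a i) (a i') * sqDist (b j) (b j')

theorem isWeakSimilarity_of_congruent {ι : Type*} {a b : ι → Fin d → ℤ} {t : ℝ}
    (h : Congruent (fun i => t • latticePoint (a i)) fun i => latticePoint (b i)) :
    IsWeakSimilarity a b := by
  intro i i' j j'
  have : (sqDist (a j) (a j') * sqDist (b i) (b i') : ℝ) =
      sqDist (a i) (a i') * sqDist (b j) (b j') := by
    rw [← sq_mul_sqDist_of_congruent h, ← sq_mul_sqDist_of_congruent h]
    ring
  exact_mod_cast this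

theorem IsWeakSimilarity.injective_or_constant {ι : Type*} {a b : ι → Fin d → ℤ}
    (h : IsWeakSimilarity a b) (ha : Function.Injective a) :
    Function.Injective b ∨ ∀ i j, b i = b j := by
  refine or_iff_not_imp_right.mpr fun hb i i' hii => ?_
  push Not at hb
  obtain ⟨j, j', hj⟩ := hb
  have hzero := h i i' j j'
  rw [hii, sqDist_self, mul_zero, eq_comm, mul_eq_zero, sqDist_eq_zero, sqDist_eq_zero] at hzero
  exact ha (hzero.resolve_right hj)

theorem exists_pos_generic {κ I : Type*} [Finite I] (p : I → MvPolynomial κ ℤ) :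
    ∃ M : κ → ℤ, (∀ x, 0 < M x) ∧
      ∀ i, MvPolynomial.eval M (p i) = 0 → ∀ N, MvPolynomial.eval N (p i) = 0 := by
  classical
  have := Fintype.ofFinite I
  by_contra! h
  have hprod : ∏ i, (if p i = 0 then 1 else p i) = 0 := by
    refine MvPolynomial.funext_set (fun _ => Set.Ioi 0) (fun _ => Set.Ioi_infinite 0) fun M hM => ?_
    obtain ⟨i, hi, N, hN⟩ := h M fun x => hM x (Set.mem_univ x)
    have hpi : p i ≠ 0 := fun h0 => hN (by rw [h0, map_zero])
    rw [map_prod, map_zero]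
    exact Finset.prod_eq_zero (Finset.mem_univ i) (by rw [if_neg hpi, hi])
  obtain ⟨i, -, hi⟩ := Finset.prod_eq_zero_iff.mp hprod
  split_ifs at hi with h0
  · exact one_ne_zero hi
  · exact h0 hi

variable {F : Finset (Fin d → ℤ)} {κ : Type*} [Fintype κ]

/-- The affine projection of words over `F` to `ℤ^d` with weights `M` and translation `B`. -/
def wordProjection (M : κ → ℤ) (B : Fin d → ℤ) (w : κ → F) : Fin d → ℤ :=
  B + ∑ x, M x • (w x : Fin d → ℤ)

theorem exists_wordProjection_line_eq {M : κ → ℤ} (hM : ∀ x, 0 < M x) (B : Fin d → ℤ)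
    (L : Line F κ) : ∃ (v : Fin d → ℤ) (m : ℤ), 0 < m ∧
      ∀ f, wordProjection M B (L f) = v + m • (f : Fin d → ℤ) := by
  obtain ⟨x₀, hx₀⟩ := L.proper
  refine ⟨B + ∑ x, M x • (L.idxFun x).elim 0 (↑), ∑ x, M x * (L.idxFun x).elim 1 fun _ => 0,
    Finset.sum_pos' (fun x _ => ?_) ⟨x₀, Finset.mem_univ _, by simp [hx₀, hM]⟩, fun f => ?_⟩
  · cases L.idxFun x <;> simp [(hM x).le]
  · rw [wordProjection, Finset.sum_smul, add_assoc, ← Finset.sum_add_distrib]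
    congr 1
    refine Finset.sum_congr rfl fun x _ => ?_
    rw [Line.coe_apply]
    cases L.idxFun x <;> simp

theorem exists_forall_one_le_wordProjection (F : Finset (Fin d → ℤ)) (M : κ → ℤ) :
    ∃ B, ∀ (w : κ → F) i, 1 ≤ wordProjection M B w i := by
  obtain ⟨b, hb⟩ := Finite.exists_ge fun z : (κ → F) × Fin d => wordProjection M 0 z.1 z.2
  refine ⟨fun _ => 1 - b, fun w i => ?_⟩
  have := hb (w, i)
  simp only [wordProjection, Pi.add_apply, Pi.zero_apply] at this ⊢
  linarith

/-- The squared distance of the projections of two words, as a polynomial in the weights. -/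
noncomputable def sqDistPolynomial (w w' : κ → F) : MvPolynomial κ ℤ :=
  ∑ i, (∑ x, MvPolynomial.X x * MvPolynomial.C ((w x).1 i - (w' x).1 i)) ^ 2

theorem eval_sqDistPolynomial (M : κ → ℤ) (B : Fin d → ℤ) (w w' : κ → F) :
    MvPolynomial.eval M (sqDistPolynomial w w') =
      sqDist (wordProjection M B w) (wordProjection M B w') := by
  simp [sqDistPolynomial, sqDist, wordProjection, dotProduct, mul_sub, Finset.sum_sub_distrib, sq]

theorem eval_single_sqDistPolynomial [DecidableEq κ] (x : κ) (w w' : κ → F) :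
    MvPolynomial.eval (Pi.single x 1) (sqDistPolynomial w w') = sqDist (w x).1 (w' x).1 := by
  rw [eval_sqDistPolynomial _ 0]
  simp [wordProjection, Pi.single_apply]

theorem exists_weights_isWeakSimilarity (F : Finset (Fin d → ℤ)) (κ : Type*) [Fintype κ] :
    ∃ M : κ → ℤ, (∀ x, 0 < M x) ∧ ∀ (B : Fin d → ℤ) (g : F → κ → F),
      IsWeakSimilarity (fun f : F => f.1) (fun f => wordProjection M B (g f)) →
        ∀ x, IsWeakSimilarity (fun f : F => f.1) fun f => (g f x).1 := by
  classical
  obtain ⟨M, hM, hgen⟩ := exists_pos_generic fun z : (F → κ → F) × F × F × F × F =>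
    let ⟨g, i, i', j, j'⟩ := z
    MvPolynomial.C (sqDist j.1 j'.1) * sqDistPolynomial (g i) (g i') -
      MvPolynomial.C (sqDist i.1 i'.1) * sqDistPolynomial (g j) (g j')
  refine ⟨M, hM, fun B g h x i i' j j' => sub_eq_zero.mp ?_⟩
  have heval := hgen (g, i, i', j, j')
  simp only [map_sub, map_mul, MvPolynomial.eval_C] at heval
  simp only [eval_sqDistPolynomial M B] at heval
  simpa only [eval_single_sqDistPolynomial] using
    heval (sub_eq_zero.mpr (h i i' j j')) (Pi.single x 1)

/-- A map from words over `F` to points of `ℤ^d` with positive coordinates that sends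
combinatorial lines to homothetic copies of `F`, and under which only quasi-lines can become
congruent to a nonzero multiple of `F`. -/
structure IsGenericProjection {κ : Type*} (F : Finset (Fin d → ℤ)) (φ : (κ → F) → Fin d → ℤ) :
    Prop where
  one_le : ∀ w i, 1 ≤ φ w i
  map_line : ∀ L : Line F κ, ∃ (v : Fin d → ℤ) (m : ℤ), 0 < m ∧
    ∀ f, φ (L f) = v + m • (f : Fin d → ℤ)
  isQuasiLine : ∀ (g : F → κ → F) (t : ℝ), t ≠ 0 →
    Congruent (fun f : F => t • latticePoint f.1) (fun f => latticePoint (φ (g f))) →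
      IsQuasiLine g

theorem exists_isGenericProjection (hF : F.Nontrivial) (κ : Type*) [Finite κ] :
    ∃ φ : (κ → F) → Fin d → ℤ, IsGenericProjection F φ := by
  have := Fintype.ofFinite κ
  obtain ⟨M, hM, hgen⟩ := exists_weights_isWeakSimilarity F κ
  obtain ⟨B, hB⟩ := exists_forall_one_le_wordProjection F M
  refine ⟨wordProjection M B, hB, exists_wordProjection_line_eq hM B, fun g t ht hcong => ?_⟩
  have hcoord (x : κ) : (Function.Injective fun f => g f x) ∨ ∀ f f', g f x = g f' x :=
    ((hgen B g (isWeakSimilarity_of_congruent hcong) x).injective_or_constant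
      Subtype.val_injective).imp .of_comp fun h f f' => Subtype.ext (h f f')
  refine ⟨?_, hcoord⟩
  by_contra! hconst
  obtain ⟨f, hf, f', hf', hne⟩ := hF
  have heq : g ⟨f, hf⟩ = g ⟨f', hf'⟩ := funext fun x => (hcoord x).resolve_left (hconst x) _ _
  have hzero := sq_mul_sqDist_of_congruent hcong ⟨f, hf⟩ ⟨f', hf'⟩
  rw [heq, sqDist_self, Int.cast_zero, mul_eq_zero, Int.cast_eq_zero, sqDist_eq_zero] at hzero
  exact hzero.elim (pow_ne_zero 2 ht) hne

end GenericProjection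

section LabelledPoints

variable {d : ℕ} {F : Finset (Fin d → ℤ)} {V κ : Type*} [Finite κ] {ℰ : Set (Set V)}
  {φ : (κ → F) → Fin d → ℤ} {S : Set V} {Lab : (κ → F) → V → Prop}

open Classical in
/-- The lattice points obtained by projecting the labelled words of a picture. -/
noncomputable def labelledPoints (φ : (κ → F) → Fin d → ℤ) (Lab : (κ → F) → V → Prop) :
    Finset (Fin d → ℤ) :=
  (Set.toFinite (φ '' {w | ∃ u, Lab w u})).toFinset

theorem coe_labelledPoints : (labelledPoints φ Lab : Set (Fin d → ℤ)) = φ '' {w | ∃ u, Lab w u} :=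
  Set.Finite.coe_toFinset _

theorem mem_labelledPoints_of_label {w : κ → F} {u : V} (h : Lab w u) :
    φ w ∈ labelledPoints φ Lab := by
  rw [← Finset.mem_coe, coe_labelledPoints]
  exact ⟨w, ⟨u, h⟩, rfl⟩

theorem IsGenericProjection.one_le_of_mem_labelledPoints (hφ : IsGenericProjection F φ)
    {x : Fin d → ℤ} (hx : x ∈ labelledPoints φ Lab) (i : Fin d) : 1 ≤ x i := by
  rw [← Finset.mem_coe, coe_labelledPoints] at hx
  obtain ⟨w, -, rfl⟩ := hx
  exact hφ.one_le w i

theorem IsPicture.hasMonochromaticHomotheticCopy {r : ℕ} [Nonempty (Fin r)]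
    (hP : IsPicture ℰ (Fin r) Set.univ Lab) (hφ : IsGenericProjection F φ)
    (hℰ : ∀ χ : V → Fin r, ∃ e : F → V, IsEdgeTuple ℰ e ∧ ∃ j, ∀ f, χ (e f) = j)
    (c : labelledPoints φ Lab → Fin r) :
    HasMonochromaticHomotheticCopy F (labelledPoints φ Lab) c := by
  classical
  obtain ⟨χ, hχ⟩ := hP.ramsey fun w =>
    if h : φ w ∈ labelledPoints φ Lab then c ⟨φ w, h⟩ else Classical.arbitrary (Fin r)
  obtain ⟨e, he, j, hj⟩ := hℰ χ
  obtain ⟨L, hLab, hcolor⟩ := hχ e he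
  obtain ⟨v, m, hm, hL⟩ := hφ.map_line L
  refine ⟨v, m, hm, j, fun f hf => ?_⟩
  have hmem : φ (L ⟨f, hf⟩) ∈ labelledPoints φ Lab := mem_labelledPoints_of_label (hLab _)
  have hc := hcolor ⟨f, hf⟩ (Set.mem_univ _)
  rw [dif_pos hmem, hj] at hc
  simp only [hL] at hmem hc
  exact ⟨hmem, hc⟩

theorem IsPicture.exists_isFreeOf {C : Type*} {μ : ℝ} (hP : IsPicture ℰ C S Lab)
    (hφ : IsGenericProjection F φ) (hμ : IsFractionallyIndependent ℰ μ)
    {Y : Finset (Fin d → ℤ)} (hY : Y ⊆ labelledPoints φ Lab) :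
    ∃ Z ⊆ Y, IsFreeOf F Z ∧ μ * Y.card ≤ Z.card := by
  classical
  have hword (y : Y) : ∃ w u, Lab w u ∧ φ w = y := by
    have hy := Finset.mem_coe.mpr (hY y.2)
    rw [coe_labelledPoints] at hy
    obtain ⟨w, ⟨u, hu⟩, hw⟩ := hy
    exact ⟨w, u, hu, hw⟩
  choose word lab hLab hword using hword
  obtain ⟨Z, -, hZ, hcard⟩ := hμ.exists_large Finset.univ lab
  refine ⟨Z.map (.subtype _), Finset.map_subtype_subset Z, ?_, ?_⟩
  · rintro ⟨t, ht, g, hg, hcong⟩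
    choose y hy hyg using fun f => Finset.mem_map.mp (hg f)
    obtain rfl : g = fun f => φ (word (y f)) := funext fun f => by
      rw [hword, ← hyg f, Function.Embedding.coe_subtype]
    have hedge : IsEdgeTuple ℰ fun f => lab (y f) :=
      hP.faithful _ (hφ.isQuasiLine _ t ht hcong) _ fun f => hLab (y f)
    exact hZ _ hedge.2 (Set.range_subset_iff.mpr fun f => Set.mem_image_of_mem lab (hy f))
  · simpa only [Finset.card_univ, Fintype.card_coe, Finset.card_map] using hcard

end LabelledPoints

theorem proposition2p2 (d : ℕ) (F : Finset (Fin d → ℤ)) (hF : 3 ≤ F.card)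
    (r : ℕ) (hr : 1 ≤ r) (μ : ℝ) (hμ0 : 0 < μ)
    (hμ1 : μ < ((F.card : ℝ) - 1) / (F.card : ℝ)) :
    ∃ X : Finset (Fin d → ℤ), (∀ x ∈ X, ∀ i, 1 ≤ x i) ∧
      (∀ c : X → Fin r, HasMonochromaticHomotheticCopy F X c) ∧
      (∀ Y ⊆ X, ∃ Z ⊆ Y, IsFreeOf F Z ∧ μ * (Y.card : ℝ) ≤ (Z.card : ℝ)) := by
  have : Nonempty (Fin r) := ⟨⟨0, hr⟩⟩
  obtain ⟨l, hl⟩ : ∃ l, F.card = l + 1 := Nat.exists_eq_add_of_le' (by omega)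
  obtain ⟨V, _, ℰ, hlinear, hμ, hramsey⟩ :=
    exists_hypergraph (l := l) (μ := μ) (by simpa [hl] using hμ1) (Fin r)
  obtain ⟨κ, _, Lab, hP⟩ :=
    exists_picture (K := F) (C := Fin r) (by simpa using hF) hlinear
  obtain ⟨φ, hφ⟩ :=
    exists_isGenericProjection (Finset.one_lt_card_iff_nontrivial.mp (by omega : 1 < F.card)) κ
  refine ⟨labelledPoints φ Lab, fun x hx => hφ.one_le_of_mem_labelledPoints hx,
    hP.hasMonochromaticHomotheticCopy hφ fun χ => ?_, fun Y hY => hP.exists_isFreeOf hφ hμ hY⟩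
  obtain ⟨e, he, hχ⟩ := hramsey χ
  let σ := F.equivFinOfCardEq hl
  exact ⟨e ∘ σ, ⟨he.1.comp σ.injective, σ.surjective.range_comp e ▸ he.2⟩,
    hχ.imp fun j hj f => hj (σ f)⟩
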